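/- Let $X$ be a continuous domain, that is, a poset in which every (nonempty) directed subset has a supremum and in which, for every $x\in X$, the set $\{a : a\ll x\}$ is directed with supremum $x$; here $a\ll x$ means that for every directed $D\subseteq X$ with $x\le\bigvee D$ there is $d\in D$ with $a\le d$. Give $X$ its Scott topology, with lattice of open sets $\mathcal O(X)$. The valuation powerdomain $\mathcal V(X)$ is the set of all continuous valuations on $X$, i.e. of maps $\mu:\mathcal O(X)\to[0,\infty]$ with $\mu(\emptyset)=0$, $\mu(V)\le\mu(U)$ if $V\subseteq U$, $\mu(U)+\mu(V)=\mu(U\cup V)+\mu(U\cap V)$, and $\mu(\bigcup\mathcal D)=\sup_{U\in\mathcal D}\mu(U)$ for every directed $\mathcal D\subseteq\mathcal O(X)$, ordered pointwise; $\sigma(\mathcal V(X))$ denotes the Scott topology of this poset. For $x\in X$ let $\eta_x(U)=1$ if $x\in U$ and $\eta_x(U)=0$ otherwise. Let $\mathcal{SV}(X)\subseteq\mathcal V(X)$ be the set of simple valuations $\sum_{b\in B}r_b\eta_b$ with $B\subseteq X$ finite (possibly empty) and $0<r_b<\infty$, with the pointwise order. For a directed set $\mathcal D\subseteq\mathcal{SV}(X)$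 and $\xi=\sum_{b\in B}r_b\eta_b\in\mathcal{SV}(X)$ write $\mathcal D\Rightarrow_P\xi$ if there are directed sets $D_b\subseteq X$ $(b\in B)$, each converging to $b$ in $X$ (as a net indexed by itself), such that for all $(d_b)_{b\in B}\in\prod_{b\in B}D_b$ and all real numbers $0\le r'_b<r_b$ $(b\in B)$ there is $\xi'\in\mathcal D$ with $\sum_{b\in B}r'_b\eta_{d_b}\le\xi'$. Let $O_{\Rightarrow_P}(\mathcal{SV}(X))$ be the topology of all $\mathcal U\subseteq\mathcal{SV}(X)$ such that, for every directed $\mathcal D\subseteq\mathcal{SV}(X)$ and every $\xi\in\mathcal{SV}(X)$, $\mathcal D\Rightarrow_P\xi\in\mathcal U$ implies $\mathcal D\cap\mathcal U\ne\emptyset$, and let $CX=(\mathcal{SV}(X),O_{\Rightarrow_P}(\mathcal{SV}(X)))$. Then $O_{\Rightarrow_P}(\mathcal{SV}(X))$ equals the relative topology $\sigma(\mathcal V(X))|_{\mathcal{SV}(X)}$ on $\mathcal{SV}(X)$; that is, $CX$ is a topological subspace of $(\mathcal V(X),\sigma(\mathcal V(X)))$. -/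

import Mathlib

open scoped NNReal ENNReal

/-! ### Continuous domains -/

/-- A directed subset of a type with respect to a relation: nonempty, and any two members have an
upper bound inside the subset. -/
def IsDirectedSet {α : Type*} (le : α → α → Prop) (D : Set α) : Prop :=
  D.Nonempty ∧ DirectedOn le D

/-- `x ≪ y`: whenever the supremum of a directed set is above `y`, some member of the directed
set is above `x`. -/
def WayBelow {P : Type*} [PartialOrder P] (x y : P) : Prop :=
  ∀ (D : Set P) (s : P), IsDirectedSet (· ≤ ·) D → IsLUB D s → y ≤ s → ∃ d ∈ D, x ≤ d

/-- A dcpo: every directed subset has a supremum. No bottom element is required. -/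
def IsDcpo (P : Type*) [PartialOrder P] : Prop :=
  ∀ D : Set P, IsDirectedSet (· ≤ ·) D → ∃ s, IsLUB D s

/-- A continuous domain: a dcpo in which the elements way below any `x` form a directed set with
supremum `x`. -/
def IsContinuousDomain (P : Type*) [PartialOrder P] : Prop :=
  IsDcpo P ∧ ∀ x : P, IsDirectedSet (· ≤ ·) {a | WayBelow a x} ∧ IsLUB {a | WayBelow a x} x

/-! ### Specialization order and convergence of directed sets -/

section Spaces

variable {X : Type*} [TopologicalSpace X]

/-- The specialization order `x ⊑ y`. -/
def SpecLE (x y : X) : Prop := x ∈ closure {y}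

/-- A set `D`, directed for the specialization order and regarded as a net indexed by itself,
converges to `x`: it is eventually in every open neighbourhood of `x`. -/
def DirectedConverges (D : Set X) (x : X) : Prop :=
  ∀ U : TopologicalSpace.Opens X, x ∈ U → ∃ d₀ ∈ D, ∀ d ∈ D, SpecLE d₀ d → d ∈ U

end Spaces

/-! ### Continuous valuations and the valuation powerdomain -/

/-- Continuous valuations on the lattice of open sets of `X`. As a type with the pointwise order
this is the valuation powerdomain of `X`. -/
@[ext]
structure ContinuousValuation (X : Type*) [TopologicalSpace X] where
  toFun : TopologicalSpace.Opens X → ℝ≥0∞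
  strict' : toFun ⊥ = 0
  mono' : ∀ U V, V ≤ U → toFun V ≤ toFun U
  modular' : ∀ U V, toFun U + toFun V = toFun (U ⊔ V) + toFun (U ⊓ V)
  continuous' : ∀ 𝒟 : Set (TopologicalSpace.Opens X), IsDirectedSet (· ≤ ·) 𝒟 →
    toFun (sSup 𝒟) = ⨆ U ∈ 𝒟, toFun U

namespace ContinuousValuation

variable {X : Type*} [TopologicalSpace X]

/-- The pointwise order. -/
instance : PartialOrder (ContinuousValuation X) :=
  PartialOrder.lift toFun fun _ _ h => ContinuousValuation.ext h

theorem le_def {μ ν : ContinuousValuation X} : μ ≤ ν ↔ ∀ U, μ.toFun U ≤ ν.toFun U := Iff.rfl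

open Classical in
/-- The point valuation `η_x`. -/
noncomputable def point (x : X) : ContinuousValuation X where
  toFun U := if x ∈ U then 1 else 0
  strict' := by simp
  mono' U V h := by
    by_cases hx : x ∈ V
    · simp [hx, h hx]
    · simp [hx]
  modular' U V := by
    by_cases hU : x ∈ U <;> by_cases hV : x ∈ V <;> simp [hU, hV]
  continuous' 𝒟 _ := by
    by_cases hx : ∃ U ∈ 𝒟, x ∈ U
    · obtain ⟨U, hU, hxU⟩ := hx
      have h1 : x ∈ sSup 𝒟 := TopologicalSpace.Opens.mem_sSup.2 ⟨U, hU, hxU⟩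
      rw [if_pos h1]
      refine le_antisymm ?_ (iSup₂_le fun V _ => by split_ifs <;> simp)
      refine le_trans ?_ (le_iSup₂ U hU)
      rw [if_pos hxU]
    · have h1 : x ∉ sSup 𝒟 := fun h => hx (TopologicalSpace.Opens.mem_sSup.1 h)
      rw [if_neg h1]
      refine le_antisymm zero_le (iSup₂_le fun V hV => ?_)
      rw [if_neg fun h => hx ⟨V, hV, h⟩]

/-- The finite linear combination `∑ i ∈ s, r i • η_(x i)` of point valuations (the points `x i`
need not be distinct). -/
noncomputable def linComb {ι : Type*} (s : Finset ι) (r : ι → ℝ≥0) (x : ι → X) :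
    ContinuousValuation X where
  toFun U := ∑ i ∈ s, (r i : ℝ≥0∞) * (point (x i)).toFun U
  strict' := by simp [(point _).strict']
  mono' U V h := Finset.sum_le_sum fun i _ => by gcongr; exact (point (x i)).mono' U V h
  modular' U V := by
    simp only [← Finset.sum_add_distrib, ← mul_add, (point _).modular' U V]
  continuous' 𝒟 h𝒟 := by
    simp only [(point _).continuous' 𝒟 h𝒟, iSup_subtype', ENNReal.mul_iSup]
    refine ENNReal.finsetSum_iSup fun U V => ?_
    obtain ⟨W, hW, hUW, hVW⟩ := h𝒟.2 U U.2 V V.2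
    refine ⟨⟨W, hW⟩, fun i => ⟨?_, ?_⟩⟩
    · gcongr
      exact (point (x i)).mono' W U hUW
    · gcongr
      exact (point (x i)).mono' W V hVW

/-- `μ` is the simple valuation `∑ b ∈ B, r b • η_b` with finite support `B` and coefficients
`0 < r b < ∞`. The empty support gives the zero valuation. -/
def IsSimpleForm (μ : ContinuousValuation X) (B : Finset X) (r : X → ℝ≥0) : Prop :=
  (∀ b ∈ B, 0 < r b) ∧ μ = linComb B r id

end ContinuousValuation

/-! ### Simple valuations and the topology of `⇒_P` -/

open ContinuousValuation in
/-- The set of all simple valuations, inside the valuation powerdomain, with the pointwise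
order. -/
def SimpleValuation (X : Type*) [TopologicalSpace X] : Type _ :=
  {μ : ContinuousValuation X // ∃ B r, IsSimpleForm μ B r}

namespace SimpleValuation

variable {X : Type*} [TopologicalSpace X]

/-- The inclusion of the simple valuations into the valuation powerdomain. -/
def incl (ξ : SimpleValuation X) : ContinuousValuation X := ξ.1

instance : PartialOrder (SimpleValuation X) :=
  PartialOrder.lift incl Subtype.val_injective

open ContinuousValuation in
/-- `𝒟 ⇒_P ξ`, for `ξ = ∑ b ∈ B, r b • η_b`: there are directed sets `D b → b` (`b ∈ B`) such
that for all `d b ∈ D b` and all `r' b < r b` some `ξ' ∈ 𝒟` satisfies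
`∑ b ∈ B, r' b • η_(d b) ≤ ξ'`. -/
def ConvP (𝒟 : Set (SimpleValuation X)) (ξ : SimpleValuation X) : Prop :=
  ∃ (B : Finset X) (r : X → ℝ≥0), IsSimpleForm ξ.incl B r ∧
    ∃ D : X → Set X,
      (∀ b ∈ B, IsDirectedSet SpecLE (D b) ∧ DirectedConverges (D b) b) ∧
      ∀ (d : X → X) (r' : X → ℝ≥0), (∀ b ∈ B, d b ∈ D b) → (∀ b ∈ B, r' b < r b) →
        ∃ ξ' ∈ 𝒟, linComb B r' d ≤ ξ'.incl

/-- `⇒_P` convergence open sets of simple valuations. -/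
def IsConvPOpen (𝒰 : Set (SimpleValuation X)) : Prop :=
  ∀ (𝒟 : Set (SimpleValuation X)) (ξ : SimpleValuation X), IsDirectedSet (· ≤ ·) 𝒟 →
    ConvP 𝒟 ξ → ξ ∈ 𝒰 → (𝒟 ∩ 𝒰).Nonempty

theorem ConvP.of_le {ξ η : SimpleValuation X} (h : ξ ≤ η) : ConvP {η} ξ := by
  obtain ⟨B, r, hr, hξ⟩ := ξ.2
  refine ⟨B, r, ⟨hr, hξ⟩, fun b => {b}, fun b _ => ⟨⟨⟨b, rfl⟩, ?_⟩, ?_⟩, ?_⟩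
  · rintro x rfl y rfl
    exact ⟨_, rfl, subset_closure rfl, subset_closure rfl⟩
  · rintro U hU
    refine ⟨b, rfl, ?_⟩
    rintro d rfl -
    exact hU
  · intro d r' hd hr'
    refine ⟨η, rfl, le_trans ?_ (show ξ.incl ≤ η.incl from h)⟩
    change _ ≤ ξ.1
    rw [hξ]
    intro U
    refine Finset.sum_le_sum fun b hb => ?_
    have h1 : d b = b := hd b hb
    rw [h1]
    gcongr
    · exact (hr' b hb).le
    · exact le_rfl

theorem IsConvPOpen.mem_of_le {𝒰 : Set (SimpleValuation X)} (h𝒰 : IsConvPOpen 𝒰)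
    {ξ η : SimpleValuation X} (h : ξ ≤ η) (hξ : ξ ∈ 𝒰) : η ∈ 𝒰 := by
  obtain ⟨_, rfl, hζ⟩ := h𝒰 {η} ξ
    ⟨⟨η, rfl⟩, by rintro x rfl y rfl; exact ⟨_, rfl, le_rfl, le_rfl⟩⟩ (.of_le h) hξ
  exact hζ

/-- The topology `O_{⇒_P}` on the set of simple valuations, whose open sets are the `⇒_P`
convergence open sets; with it the simple valuations form the space `CX`. -/
abbrev convPTopology (X : Type*) [TopologicalSpace X] : TopologicalSpace (SimpleValuation X) where
  IsOpen := IsConvPOpen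
  isOpen_univ 𝒟 ξ h𝒟 _ _ := by simpa using h𝒟.1
  isOpen_inter 𝒰 𝒱 h𝒰 h𝒱 𝒟 ξ h𝒟 hc hξ := by
    obtain ⟨α, hα, hα'⟩ := h𝒰 𝒟 ξ h𝒟 hc hξ.1
    obtain ⟨β, hβ, hβ'⟩ := h𝒱 𝒟 ξ h𝒟 hc hξ.2
    obtain ⟨γ, hγ, hαγ, hβγ⟩ := h𝒟.2 α hα β hβ
    exact ⟨γ, hγ, h𝒰.mem_of_le hαγ hα', h𝒱.mem_of_le hβγ hβ'⟩
  isOpen_sUnion S hS 𝒟 ξ h𝒟 hc := by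
    rintro ⟨𝒰, h𝒰, hξ⟩
    obtain ⟨α, hα, hα'⟩ := hS 𝒰 h𝒰 𝒟 ξ h𝒟 hc hξ
    exact ⟨α, hα, 𝒰, h𝒰, hα'⟩

end SimpleValuation

/-- The Scott topology on the valuation powerdomain. -/
abbrev valuationScott (X : Type*) [TopologicalSpace X] : TopologicalSpace (ContinuousValuation X) :=
  Topology.scott (ContinuousValuation X) Set.univ

/-! ### The way-below relation of a continuous domain and its Scott topology -/

section Domain

variable {P : Type*} [PartialOrder P]

/-! If `𝒟 ⇒_P ξ`, then `ξ` lies below the supremum of `𝒟` in the valuation powerdomain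
(`ConvP.incl_le`), so a Scott open set containing `ξ` meets `𝒟`. Hence traces of Scott open sets are
`⇒_P`-open.

Conversely, lower strictly each coefficient of `ξ` and replace each support point by one way below
it. These valuations form a directed set that `⇒_P`-converges to `ξ`, so an open `𝒰 ∋ ξ` contains
one of them; by `wayBelow_linComb` it is way below `ξ` among all continuous valuations, not only the
simple ones. The upper closure of `𝒰` is therefore Scott open, and its trace is `𝒰`. -/

theorem WayBelow.trans_le {x y z : P} (h : WayBelow x y) (hyz : y ≤ z) : WayBelow x z :=
  fun D s hD hs hz => h D s hD hs (hyz.trans hz)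

theorem WayBelow.of_le {x y z : P} (hxy : x ≤ y) (h : WayBelow y z) : WayBelow x z :=
  fun D s hD hs hz => (h D s hD hs hz).imp fun _ hd => ⟨hd.1, hxy.trans hd.2⟩

theorem WayBelow.le {x y : P} (h : WayBelow x y) : x ≤ y := by
  obtain ⟨d, hd, hxd⟩ := h {y} y ⟨⟨y, rfl⟩, by rintro a rfl b rfl; exact ⟨_, rfl, le_rfl, le_rfl⟩⟩
    isLUB_singleton le_rfl
  exact hxd.trans (le_of_eq hd)

/-- Interpolation: the elements way below some member of `D` again form a directed set with supremum
`s`. -/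
theorem WayBelow.exists_mem_wayBelow (hP : IsContinuousDomain P) {x s : P} {D : Set P}
    (hD : IsDirectedSet (· ≤ ·) D) (hs : IsLUB D s) (h : WayBelow x s) : ∃ d ∈ D, WayBelow x d := by
  have hE : IsDirectedSet (· ≤ ·) {a | ∃ e ∈ D, WayBelow a e} := by
    obtain ⟨d, hd⟩ := hD.1
    obtain ⟨a, ha⟩ := (hP.2 d).1.1
    refine ⟨⟨a, d, hd, ha⟩, ?_⟩
    rintro a ⟨e, he, hae⟩ b ⟨f, hf, hbf⟩
    obtain ⟨g, hg, heg, hfg⟩ := hD.2 e he f hf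
    obtain ⟨c, hc, hac, hbc⟩ := (hP.2 g).1.2 a (hae.trans_le heg) b (hbf.trans_le hfg)
    exact ⟨c, ⟨g, hg, hc⟩, hac, hbc⟩
  have hEs : IsLUB {a | ∃ e ∈ D, WayBelow a e} s := by
    refine ⟨?_, fun u hu => hs.2 fun e he => (hP.2 e).2.2 fun a ha => hu ⟨e, he, ha⟩⟩
    rintro a ⟨e, he, hae⟩
    exact hae.le.trans (hs.1 he)
  obtain ⟨a, ⟨e, he, hae⟩, hxa⟩ := h _ s hE hEs le_rfl
  exact ⟨e, he, .of_le hxa hae⟩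

variable [TopologicalSpace P] [Topology.IsScott P Set.univ]

theorem isOpen_setOf_wayBelow (hP : IsContinuousDomain P) (x : P) :
    IsOpen {y | WayBelow x y} := by
  rw [Topology.IsScott.isOpen_iff_isUpperSet_and_dirSupInaccOn (D := Set.univ)]
  exact ⟨fun _ _ hab ha => ha.trans_le hab,
    fun D _ hne hD _ hs h => WayBelow.exists_mem_wayBelow hP ⟨hne, hD⟩ hs h⟩

theorem specLE_iff_le {x y : P} : SpecLE x y ↔ x ≤ y := by
  rw [SpecLE, Topology.IsScott.closure_singleton, Set.mem_Iic]

theorem isDirectedSet_specLE_wayBelow (hP : IsContinuousDomain P) (x : P) :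
    IsDirectedSet SpecLE {a | WayBelow a x} := by
  refine ⟨(hP.2 x).1.1, fun a ha b hb => ?_⟩
  simpa only [specLE_iff_le] using (hP.2 x).1.2 a ha b hb

theorem directedConverges_wayBelow (hP : IsContinuousDomain P) (x : P) :
    DirectedConverges {a | WayBelow a x} x := by
  intro U hxU
  obtain ⟨hup, hacc⟩ :=
    (Topology.IsScott.isOpen_iff_isUpperSet_and_dirSupInaccOn (D := Set.univ)).1 U.isOpen
  obtain ⟨d, hd, hdU⟩ := hacc trivial (hP.2 x).1.1 (hP.2 x).1.2 (hP.2 x).2 hxU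
  exact ⟨d, hd, fun e _ hde => hup (specLE_iff_le.1 hde) hdU⟩

end Domain

namespace IsDirectedSet

theorem exists_upperBound_of_finset {α ι : Type*} [Preorder α] {D : Set α}
    (hD : IsDirectedSet (· ≤ ·) D) (s : Finset ι) {f : ι → α} (hf : ∀ i ∈ s, f i ∈ D) :
    ∃ d ∈ D, ∀ i ∈ s, f i ≤ d := by
  classical
  induction s using Finset.induction_on with
  | empty => exact hD.1.imp fun d hd => ⟨hd, by simp⟩
  | insert i s _ ih =>
    obtain ⟨d, hd, hs⟩ := ih fun j hj => hf j (Finset.mem_insert_of_mem hj)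
    obtain ⟨e, he, hie, hde⟩ := hD.2 (f i) (hf i (Finset.mem_insert_self i s)) d hd
    refine ⟨e, he, fun j hj => ?_⟩
    rcases Finset.mem_insert.1 hj with rfl | hj
    · exact hie
    · exact (hs j hj).trans hde

end IsDirectedSet

/-! ### Directed suprema of continuous valuations -/

namespace ContinuousValuation

variable {X : Type*} [TopologicalSpace X]

/-- The pointwise supremum of a directed set of continuous valuations. -/
noncomputable def directedSup (𝒟 : Set (ContinuousValuation X)) (h𝒟 : IsDirectedSet (· ≤ ·) 𝒟) :
    ContinuousValuation X where
  toFun U := ⨆ μ : 𝒟, μ.1.toFun U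
  strict' := by simp [strict']
  mono' U V h := iSup_mono fun μ => μ.1.mono' U V h
  modular' U V := by
    have key (A B : TopologicalSpace.Opens X) : (⨆ μ : 𝒟, μ.1.toFun A) + (⨆ μ : 𝒟, μ.1.toFun B) =
        ⨆ μ : 𝒟, (μ.1.toFun A + μ.1.toFun B) := by
      refine ENNReal.iSup_add_iSup fun μ ν => ?_
      obtain ⟨κ, hκ, hμ, hν⟩ := h𝒟.2 μ μ.2 ν ν.2
      exact ⟨⟨κ, hκ⟩, add_le_add (hμ A) (hν B)⟩
    rw [key, key]
    exact iSup_congr fun μ => μ.1.modular' U V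
  continuous' 𝒪 h𝒪 := by
    simp only [fun μ : 𝒟 => μ.1.continuous' 𝒪 h𝒪]
    rw [iSup_comm]
    exact iSup_congr fun U => iSup_comm

theorem isLUB_directedSup (𝒟 : Set (ContinuousValuation X)) (h𝒟 : IsDirectedSet (· ≤ ·) 𝒟) :
    IsLUB 𝒟 (directedSup 𝒟 h𝒟) :=
  ⟨fun μ hμ U => le_iSup (fun ν : 𝒟 => ν.1.toFun U) ⟨μ, hμ⟩,
    fun _ hν U => iSup_le fun μ => hν μ.2 U⟩

theorem toFun_of_isLUB {𝒟 : Set (ContinuousValuation X)} (h𝒟 : IsDirectedSet (· ≤ ·) 𝒟)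
    {μ : ContinuousValuation X} (hμ : IsLUB 𝒟 μ) (U : TopologicalSpace.Opens X) :
    μ.toFun U = ⨆ ν : 𝒟, ν.1.toFun U := by
  rw [hμ.unique (isLUB_directedSup 𝒟 h𝒟)]
  rfl

/-! ### Linear combinations of point valuations -/

open Classical in
theorem linComb_toFun {ι : Type*} (s : Finset ι) (r : ι → ℝ≥0) (x : ι → X)
    (U : TopologicalSpace.Opens X) :
    (linComb s r x).toFun U = ∑ i ∈ s with x i ∈ U, (r i : ℝ≥0∞) := by
  simp [linComb, point, Finset.sum_filter]

theorem linComb_mono {ι : Type*} [Preorder X] {s : Finset ι} {r r' : ι → ℝ≥0} {x x' : ι → X}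
    (hU : ∀ U : TopologicalSpace.Opens X, IsUpperSet (U : Set X))
    (hr : ∀ i ∈ s, r i ≤ r' i) (hx : ∀ i ∈ s, x i ≤ x' i) : linComb s r x ≤ linComb s r' x' := by
  classical
  intro U
  rw [linComb_toFun, linComb_toFun, Finset.sum_filter, Finset.sum_filter]
  refine Finset.sum_le_sum fun i hi => ?_
  by_cases h : x i ∈ U
  · rw [if_pos h, if_pos (show x' i ∈ U from hU U (hx i hi) h)]
    exact ENNReal.coe_le_coe.2 (hr i hi)
  · simp [h]

/-- Dropping zero coefficients and merging equal points gives a simple form. This is needed because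
lowered coefficients may vanish and lowered points may coincide. -/
theorem exists_isSimpleForm_linComb {ι : Type*} (s : Finset ι) (r : ι → ℝ≥0) (x : ι → X) :
    ∃ B t, IsSimpleForm (linComb s r x) B t := by
  classical
  refine ⟨{i ∈ s | 0 < r i}.image x, fun y => ∑ i ∈ {i ∈ s | 0 < r i} with x i = y, r i, ?_, ?_⟩
  · intro b hb
    obtain ⟨i, hi, rfl⟩ := Finset.mem_image.1 hb
    exact Finset.sum_pos (fun j hj => (Finset.mem_filter.1 (Finset.mem_filter.1 hj).1).2)
      ⟨i, Finset.mem_filter.2 ⟨hi, rfl⟩⟩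
  · ext U
    have h : ∑ i ∈ s, (r i : ℝ≥0∞) * (point (x i)).toFun U =
        ∑ i ∈ s with 0 < r i, (r i : ℝ≥0∞) * (point (x i)).toFun U := by
      refine (Finset.sum_subset (Finset.filter_subset _ _) fun i hi hi' => ?_).symm
      have : r i = 0 := by simpa [hi] using hi'
      simp [this]
    change ∑ i ∈ s, (r i : ℝ≥0∞) * (point (x i)).toFun U = ∑ b ∈ _, _ * (point (id b)).toFun U
    rw [h, ← Finset.sum_fiberwise_of_maps_to fun i hi => Finset.mem_image_of_mem x hi]
    refine Finset.sum_congr rfl fun b _ => ?_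
    rw [ENNReal.ofNNReal_finsetSum, Finset.sum_mul]
    refine Finset.sum_congr rfl fun i hi => ?_
    rw [(Finset.mem_filter.1 hi).2, id]

/-- Lowering strictly every coefficient, and every point in the way-below order, yields a valuation
way below the original one. -/
theorem wayBelow_linComb [PartialOrder X] [Topology.IsScott X Set.univ]
    (hX : IsContinuousDomain X) {ι : Type*} {s : Finset ι} {r r' : ι → ℝ≥0} {x x' : ι → X}
    (hr : ∀ i ∈ s, r' i < r i) (hx : ∀ i ∈ s, WayBelow (x' i) (x i)) :
    WayBelow (linComb s r' x') (linComb s r x) := by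
  classical
  intro 𝒟 μ h𝒟 hμ hle
  -- An open `U` enters only through `A = {i | x' i ∈ U}`, and `W A ≤ U`. So finitely many test sets
  -- suffice, and directedness gives one `ν` for all of them.
  let W (A : Finset ι) : TopologicalSpace.Opens X :=
    ⨆ i ∈ A, ⟨{y | WayBelow (x' i) y}, isOpen_setOf_wayBelow hX (x' i)⟩
  have hW {A : Finset ι} {y : X} : y ∈ W A ↔ ∃ i ∈ A, WayBelow (x' i) y := by
    simp only [W, TopologicalSpace.Opens.mem_iSup, exists_prop]
    rfl
  have key : ∀ A ∈ s.powerset, ∃ ν ∈ 𝒟, ∑ i ∈ A, (r' i : ℝ≥0∞) ≤ ν.toFun (W A) := by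
    intro A hA
    rw [Finset.mem_powerset] at hA
    -- The strict inequality that passes to a member of `𝒟` fails for an empty sum.
    rcases A.eq_empty_or_nonempty with rfl | hne
    · exact h𝒟.1.imp fun ν hν => ⟨hν, by simp⟩
    · have h1 : ∑ i ∈ A, (r' i : ℝ≥0∞) < μ.toFun (W A) := by
        calc ∑ i ∈ A, (r' i : ℝ≥0∞) < ∑ i ∈ A, (r i : ℝ≥0∞) := by
              exact_mod_cast Finset.sum_lt_sum_of_nonempty hne fun i hi => hr i (hA hi)
          _ ≤ (linComb s r x).toFun (W A) := by
              rw [linComb_toFun]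
              refine Finset.sum_le_sum_of_subset fun i hi => Finset.mem_filter.2 ⟨hA hi, ?_⟩
              exact hW.2 ⟨i, hi, hx i (hA hi)⟩
          _ ≤ μ.toFun (W A) := hle _
      rw [toFun_of_isLUB h𝒟 hμ] at h1
      obtain ⟨ν, hν⟩ := lt_iSup_iff.1 h1
      exact ⟨ν.1, ν.2, hν.le⟩
  have : Nonempty (ContinuousValuation X) := ⟨μ⟩
  choose! f hf hfW using key
  obtain ⟨ν, hν, hνf⟩ := h𝒟.exists_upperBound_of_finset s.powerset hf
  refine ⟨ν, hν, fun U => ?_⟩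
  have hA : {i ∈ s | x' i ∈ U} ∈ s.powerset := Finset.mem_powerset.2 (Finset.filter_subset _ _)
  rw [linComb_toFun]
  refine (hfW _ hA).trans ((hνf _ hA _).trans (ν.mono' _ _ fun y hy => ?_))
  obtain ⟨i, hi, hiy⟩ := hW.1 hy
  exact (Topology.IsScott.isUpperSet_of_isOpen (D := Set.univ) U.isOpen) hiy.le
    (Finset.mem_filter.1 hi).2

end ContinuousValuation

/-! ### Comparison of the two topologies -/

namespace SimpleValuation

open ContinuousValuation

variable {X : Type*} [TopologicalSpace X]

theorem isDirectedSet_image_incl {𝒟 : Set (SimpleValuation X)} (h𝒟 : IsDirectedSet (· ≤ ·) 𝒟) :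
    IsDirectedSet (· ≤ ·) (incl '' 𝒟) := by
  refine ⟨h𝒟.1.image _, ?_⟩
  rintro _ ⟨α, hα, rfl⟩ _ ⟨β, hβ, rfl⟩
  obtain ⟨γ, hγ, hαγ, hβγ⟩ := h𝒟.2 α hα β hβ
  exact ⟨γ.incl, ⟨γ, hγ, rfl⟩, hαγ, hβγ⟩

theorem ConvP.incl_le {𝒟 : Set (SimpleValuation X)} {ξ : SimpleValuation X} (h : ConvP 𝒟 ξ)
    {μ : ContinuousValuation X} (hμ : ∀ ξ' ∈ 𝒟, ξ'.incl ≤ μ) : ξ.incl ≤ μ := by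
  classical
  obtain ⟨B, r, ⟨hr, hξ⟩, D, hD, hlim⟩ := h
  intro U
  -- With `U` fixed, each `d b` need only enter `U` when `b` does; the other points contribute
  -- nothing to the value of `ξ` at `U`.
  have hd : ∀ b ∈ B, ∃ d ∈ D b, b ∈ U → d ∈ U := by
    intro b hb
    by_cases hbU : b ∈ U
    · obtain ⟨d, hd, hdU⟩ := (hD b hb).2 U hbU
      exact ⟨d, hd, fun _ => hdU d hd (subset_closure rfl)⟩
    · exact (hD b hb).1.1.imp fun d hd => ⟨hd, fun h => absurd h hbU⟩
  choose! d hd hdU using hd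
  rw [hξ, linComb_toFun]
  -- Scaling by `t < 1` makes all coefficients strictly smaller, as they are positive; then `t`
  -- tends to `1`.
  refine ENNReal.le_of_forall_lt_one_mul_le fun t ht => ?_
  lift t to ℝ≥0 using ht.ne_top
  obtain ⟨ξ', hξ', hle⟩ := hlim d (fun b => t * r b) hd
    fun b hb => mul_lt_of_lt_one_left (hr b hb) (by exact_mod_cast ht)
  refine le_trans ?_ ((hle U).trans (hμ ξ' hξ' U))
  rw [linComb_toFun, Finset.mul_sum]
  push_cast
  refine Finset.sum_le_sum_of_subset fun b hb => ?_
  rw [Finset.mem_filter] at hb ⊢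
  exact ⟨hb.1, hdU b hb.1 hb.2⟩

theorem isConvPOpen_preimage_incl {U : Set (ContinuousValuation X)}
    (hU : @IsOpen _ (valuationScott X) U) : IsConvPOpen (incl ⁻¹' U) := by
  let _ := valuationScott X
  have : Topology.IsScott (ContinuousValuation X) Set.univ := ⟨rfl⟩
  obtain ⟨hup, hacc⟩ :=
    (Topology.IsScott.isOpen_iff_isUpperSet_and_dirSupInaccOn (D := Set.univ)).1 hU
  intro 𝒟 ξ h𝒟 hconv hξ
  have h𝒟' := isDirectedSet_image_incl h𝒟
  have hlub := isLUB_directedSup _ h𝒟'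
  obtain ⟨_, ⟨α, hα, rfl⟩, hαU⟩ := hacc trivial h𝒟'.1 h𝒟'.2 hlub
    (hup (hconv.incl_le fun ξ' hξ' => hlub.1 ⟨ξ', hξ', rfl⟩) hξ)
  exact ⟨α, hα, hαU⟩

variable [PartialOrder X] [Topology.IsScott X Set.univ]

theorem IsConvPOpen.exists_mem_wayBelow (hX : IsContinuousDomain X)
    {𝒰 : Set (SimpleValuation X)} (h𝒰 : IsConvPOpen 𝒰) {ξ : SimpleValuation X} (hξ : ξ ∈ 𝒰) :
    ∃ ξ' ∈ 𝒰, WayBelow ξ'.incl ξ.incl := by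
  obtain ⟨B, r, hr, hform⟩ := ξ.2
  let 𝒟 : Set (SimpleValuation X) := {η | ∃ (d : X → X) (t : X → ℝ≥0),
    (∀ b ∈ B, WayBelow (d b) b) ∧ (∀ b ∈ B, t b < r b) ∧ η.incl = linComb B t d}
  have h𝒟 : IsDirectedSet (· ≤ ·) 𝒟 := by
    constructor
    · choose d hd using fun b => (hX.2 b).1.1
      -- Zero coefficients are admissible because every `r b` is positive.
      exact ⟨⟨linComb B 0 d, exists_isSimpleForm_linComb _ _ _⟩, d, 0, fun b _ => hd b, hr, rfl⟩
    · rintro α ⟨d, t, hd, ht, hα⟩ β ⟨e, u, he, hu, hβ⟩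
      have hub : ∀ b ∈ B, ∃ c, WayBelow c b ∧ d b ≤ c ∧ e b ≤ c := fun b hb =>
        (hX.2 b).1.2 (d b) (hd b hb) (e b) (he b hb)
      choose! c hc hdc hec using hub
      have hup (U : TopologicalSpace.Opens X) : IsUpperSet (U : Set X) :=
        Topology.IsScott.isUpperSet_of_isOpen (D := Set.univ) U.isOpen
      refine ⟨⟨linComb B (t ⊔ u) c, exists_isSimpleForm_linComb _ _ _⟩,
        ⟨c, t ⊔ u, hc, fun b hb => max_lt (ht b hb) (hu b hb), rfl⟩, ?_, ?_⟩
      · exact hα.le.trans (linComb_mono hup (fun b _ => le_max_left _ _) hdc)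
      · exact hβ.le.trans (linComb_mono hup (fun b _ => le_max_right _ _) hec)
  have hconv : ConvP 𝒟 ξ := by
    refine ⟨B, r, ⟨hr, hform⟩, fun b => {a | WayBelow a b}, fun b _ =>
      ⟨isDirectedSet_specLE_wayBelow hX b, directedConverges_wayBelow hX b⟩, fun d t hd ht => ?_⟩
    exact ⟨⟨linComb B t d, exists_isSimpleForm_linComb _ _ _⟩, ⟨d, t, hd, ht, rfl⟩, le_rfl⟩
  obtain ⟨ξ', ⟨d, t, hd, ht, h⟩, hξ'⟩ := h𝒰 𝒟 ξ h𝒟 hconv hξ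
  refine ⟨ξ', hξ', ?_⟩
  rw [h, show ξ.incl = _ from hform]
  exact wayBelow_linComb hX ht hd

theorem IsConvPOpen.isOpen_upperClosure (hX : IsContinuousDomain X)
    {𝒰 : Set (SimpleValuation X)} (h𝒰 : IsConvPOpen 𝒰) :
    @IsOpen _ (valuationScott X) {μ | ∃ ξ ∈ 𝒰, ξ.incl ≤ μ} := by
  let _ := valuationScott X
  have : Topology.IsScott (ContinuousValuation X) Set.univ := ⟨rfl⟩
  rw [Topology.IsScott.isOpen_iff_isUpperSet_and_dirSupInaccOn (D := Set.univ)]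
  refine ⟨?_, ?_⟩
  · rintro μ ν hμν ⟨ξ, hξ, hle⟩
    exact ⟨ξ, hξ, hle.trans hμν⟩
  · rintro 𝒟 - hne hdir μ hμ ⟨ξ, hξ, hle⟩
    obtain ⟨ξ', hξ', hway⟩ := h𝒰.exists_mem_wayBelow hX hξ
    obtain ⟨ν, hν, hle'⟩ := hway 𝒟 μ ⟨hne, hdir⟩ hμ hle
    exact ⟨ν, hν, ξ', hξ', hle'⟩

theorem convPTopology_eq_induced (hX : IsContinuousDomain X) :
    convPTopology X = TopologicalSpace.induced incl (valuationScott X) := by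
  let _ := valuationScott X
  refine TopologicalSpace.ext_iff.2 fun 𝒰 => ⟨fun h𝒰 => ?_, ?_⟩
  · refine isOpen_induced_iff.2 ⟨_, IsConvPOpen.isOpen_upperClosure hX h𝒰, ?_⟩
    ext η
    -- The upper closure adds no simple valuation, since `𝒰` is already an upper set.
    exact ⟨fun ⟨ξ, hξ, hle⟩ => IsConvPOpen.mem_of_le h𝒰 hle hξ, fun hη => ⟨η, hη, le_rfl⟩⟩
  · intro h
    obtain ⟨U, hU, rfl⟩ := isOpen_induced_iff.1 h
    exact isConvPOpen_preimage_incl hU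

end SimpleValuation

theorem mainTheorem4 {X : Type*} [PartialOrder X] [TopologicalSpace X]
    [Topology.IsScott X Set.univ] (hX : IsContinuousDomain X) :
    SimpleValuation.convPTopology X =
        TopologicalSpace.induced SimpleValuation.incl (valuationScott X) ∧
      @Topology.IsEmbedding (SimpleValuation X) (ContinuousValuation X)
        (SimpleValuation.convPTopology X) (valuationScott X) SimpleValuation.incl := by
  have h := SimpleValuation.convPTopology_eq_induced hX
  let _ := SimpleValuation.convPTopology X
  let _ := valuationScott X
  exact ⟨h, ⟨⟨h⟩, Subtype.val_injective⟩⟩
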